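/- Let $(\mathcal X,d)$ be a compact metric space with its Borel $\sigma$-algebra and let $\omega$ be a Borel probability measure on $\mathcal X$ that is not purely atomic, i.e. $\omega(\{x\in\mathcal X:\omega(\{x\})=0\})>0$ (for instance any non-atomic $\omega$). Let $1<p<\infty$, $p\neq 2$. Let $$\Omega=\{F:\mathcal X\to\mathcal X \text{ measurable},\ F_\#\omega=\omega\},\qquad \Lambda=\{\mathrm{ev}_x: F\mapsto F(x)\mid x\in\mathcal X\},$$ where the elements of $\Omega$ are functions, not classes modulo null sets. Let $\mathcal K_F f=f\circ F$ be the Koopman operator on $L^p(\mathcal X,\omega)$ (complex-valued functions), and let $$\Xi(F)=\sigma_{\mathrm{ap}}(\mathcal K_F)=\{\lambda\in\mathbb C:\ \exists (f_n)\subset L^p(\mathcal X,\omega),\ \|f_n\|_p=1,\ \|(\mathcal K_F-\lambda)f_n\|_p\to 0\},$$ an element of the space $\mathcal M_{\mathrm H}$ of non-empty compact subsets of $\mathbb C$ with the Hausdorff metric. For a set $\Omega$, a metric space $\mathcal M$, a map $\Xi:\Omega\to\mathcal M$ and a set $\Lambda$ of functions on $\Omega$, a *general algorithm* is a map $\Gamma:\Omega\to\mathcal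 M$ such that to every $A\in\Omega$ there is a non-empty finite set $\Lambda_\Gamma(A)\subset\Lambda$ with the following property: if $B\in\Omega$ and $f(A)=f(B)$ for all $f\in\Lambda_\Gamma(A)$, then $\Lambda_\Gamma(A)=\Lambda_\Gamma(B)$ and $\Gamma(A)=\Gamma(B)$. A *general tower of height $k$* for $\{\Xi,\Omega,\mathcal M,\Lambda\}$ is a family of maps $\Gamma_{n_k},\Gamma_{n_k,n_{k-1}},\dots,\Gamma_{n_k,\dots,n_1}:\Omega\to\mathcal M$, indexed by natural numbers, such that the maps $\Gamma_{n_k,\dots,n_1}$ are general algorithms and, pointwise on $\Omega$, $\Xi=\lim_{n_k\to\infty}\Gamma_{n_k}$, $\Gamma_{n_k}=\lim_{n_{k-1}\to\infty}\Gamma_{n_k,n_{k-1}}$, $\dots$, $\Gamma_{n_k,\dots,n_2}=\lim_{n_1\to\infty}\Gamma_{n_k,\dots,n_1}$ (for $k=0$: $\Xi$ is itself a general algorithm). $\mathrm{SCI}_G$ is the least height of a general tower ($\infty$ if there is none), and $\Delta_3^G$ is the class of problems with $\mathrm{SCI}_G\le 2$. If the functions in $\Lambda$ take values in a metric space with metric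 $d_\Lambda$ and $\Lambda$ separates inputs with different values of $\Xi$, the problem with *$\Delta_1$-information*, $\{\Xi,\Omega,\mathcal M,\Lambda\}^{\Delta_1}$, has as inputs all tuples $(a_{f,n})_{f\in\Lambda,n\in\mathbb N}$ for which some $A\in\Omega$ satisfies $d_\Lambda(a_{f,n},f(A))\le 2^{-n}$ for all $f,n$; its problem function sends such a tuple to $\Xi(A)$, and its evaluations are the coordinate functions $(a_{f,n})\mapsto a_{f,n}$. Then $$\{\Xi,\Omega,\mathcal M_{\mathrm H},\Lambda\}^{\Delta_1}\notin\Delta_3^G\qquad\text{and}\qquad \mathrm{SCI}_G(\Xi,\Omega,\mathcal M_{\mathrm H},\Lambda)\ge 3;$$ in particular, no general tower of height $2$ computes $\sigma_{\mathrm{ap}}(\mathcal K_F)$ from point evaluations of $F$. -/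

import Mathlib

open MeasureTheory Filter Topology TopologicalSpace
open scoped ENNReal

/-! ### Computational problems, general algorithms, towers, and the SCI -/

/-- A computational problem with primary set `Ω`, target space `M`, problem function `Ξ : Ω → M` and
a set `Λ` of evaluation functions on `Ω` with values in `V`. The field `consistent` is the
consistency axiom: evaluations separate inputs with different values of `Ξ`. -/
structure CompProblem (Ω M V : Type*) where
  Ξ : Ω → M
  Λ : Set (Ω → V)
  consistent : ∀ A B : Ω, Ξ A ≠ Ξ B → ∃ f ∈ Λ, f A ≠ f B

namespace CompProblem

variable {Ω M V : Type*}

/-- `Γ` is a general algorithm for `P`: to every input `A` there is a non-empty finite set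
`Q A ⊆ Λ` of evaluations such that both `Q A` and the output `Γ A` are determined by the values on
`A` of the evaluations in `Q A`. -/
def IsGeneralAlgorithm (P : CompProblem Ω M V) (Γ : Ω → M) : Prop :=
  ∃ Q : Ω → Finset (Ω → V),
    (∀ A, (Q A).Nonempty ∧ ∀ f ∈ Q A, f ∈ P.Λ) ∧
    ∀ A B, (∀ f ∈ Q A, f A = f B) → Q A = Q B ∧ Γ A = Γ B

/-- A general tower of algorithms of height `k` for `P`. The function usually written
`Γ_{n_k, …, n_j}` is `Γ [n_k, …, n_j]` here: lists of full length `k` index the base level, which consists of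
general algorithms, every function with a shorter index is the pointwise limit of the next level,
and the function with the empty index is `Ξ`. For `k = 0` this says that `Ξ` itself is a general
algorithm. -/
structure GeneralTower [MetricSpace M] (P : CompProblem Ω M V) (k : ℕ) where
  Γ : List ℕ → Ω → M
  base : ∀ l : List ℕ, l.length = k → P.IsGeneralAlgorithm (Γ l)
  lim : ∀ l : List ℕ, l.length < k → ∀ A : Ω,
    Tendsto (fun n : ℕ => Γ (l ++ [n]) A) atTop (𝓝 (Γ l A))
  top : Γ [] = P.Ξ

/-- The solvability complexity index with respect to general towers: the least height of a general
tower for `P`, and `⊤` if there is none. -/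
noncomputable def SCI [MetricSpace M] (P : CompProblem Ω M V) : ℕ∞ :=
  sInf {h : ℕ∞ | ∃ k : ℕ, h = k ∧ Nonempty (P.GeneralTower k)}

/-- The classes `Δ_m^G` of the SCI hierarchy: `Δ_0` means `SCI = 0`, `Δ_1` means computability by one
sequence of general algorithms with error at most `2^{-n}`, and `Δ_{m+1}` for `m ≥ 1` means
`SCI ≤ m`. -/
def MemDeltaG [MetricSpace M] (P : CompProblem Ω M V) : ℕ → Prop
  | 0 => P.SCI = 0
  | 1 => ∃ Γ : ℕ → Ω → M, (∀ n, P.IsGeneralAlgorithm (Γ n)) ∧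
      ∀ n A, dist (Γ n A) (P.Ξ A) ≤ (1 / 2 : ℝ) ^ n
  | m + 2 => P.SCI ≤ (m + 1 : ℕ)

/-- `a` is `Δ_1`-information on the input `A`: the entry `a f n` approximates the evaluation `f A`
with error at most `2^{-n}`. -/
def IsDeltaOneInfo [MetricSpace V] (P : CompProblem Ω M V) (a : P.Λ → ℕ → V) (A : Ω) : Prop :=
  ∀ (f : P.Λ) (n : ℕ), dist (a f n) (f.1 A) ≤ (1 / 2 : ℝ) ^ n

/-- The primary set of the problem with `Δ_1`-information: all tuples that are `Δ_1`-information on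
some input. -/
abbrev DeltaOneInput [MetricSpace V] (P : CompProblem Ω M V) : Type _ :=
  {a : P.Λ → ℕ → V // ∃ A : Ω, P.IsDeltaOneInfo a A}

/-- The problem function does not depend on the input that the information is about. -/
theorem IsDeltaOneInfo.unique [MetricSpace V] {P : CompProblem Ω M V} {a : P.Λ → ℕ → V} {A B : Ω}
    (hA : P.IsDeltaOneInfo a A) (hB : P.IsDeltaOneInfo a B) : P.Ξ A = P.Ξ B := by
  by_contra h
  obtain ⟨f, hf, hne⟩ := P.consistent A B h
  apply hne
  have h0 : Tendsto (fun n : ℕ => (1 / 2 : ℝ) ^ n) atTop (𝓝 0) :=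
    tendsto_pow_atTop_nhds_zero_of_lt_one (by norm_num) (by norm_num)
  have h1 : Tendsto (fun n => a ⟨f, hf⟩ n) atTop (𝓝 (f A)) :=
    tendsto_iff_dist_tendsto_zero.2
      (squeeze_zero (fun _ => dist_nonneg) (hA ⟨f, hf⟩) h0)
  have h2 : Tendsto (fun n => a ⟨f, hf⟩ n) atTop (𝓝 (f B)) :=
    tendsto_iff_dist_tendsto_zero.2
      (squeeze_zero (fun _ => dist_nonneg) (hB ⟨f, hf⟩) h0)
  exact tendsto_nhds_unique h1 h2

/-- The computational problem with `Δ_1`-information: inputs are all tuples of approximations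
`a f n` to the evaluations, the evaluation functions read off one entry `a f n`, and the
problem function is `Ξ A` for any `A` that `a` is information on. -/
noncomputable def deltaOne [MetricSpace V] (P : CompProblem Ω M V) :
    CompProblem P.DeltaOneInput M V where
  Ξ := fun a => P.Ξ a.2.choose
  Λ := Set.range fun (j : P.Λ × ℕ) (a : P.DeltaOneInput) => a.1 j.1 j.2
  consistent := by
    intro a b h
    by_contra hc
    push Not at hc
    apply h
    have hab : a = b := by
      apply Subtype.ext
      funext f n
      exact hc _ ⟨(f, n), rfl⟩
    rw [hab]

theorem deltaOne_apply [MetricSpace V] (P : CompProblem Ω M V) (a : P.DeltaOneInput) (A : Ω)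
    (h : P.IsDeltaOneInfo a.1 A) : P.deltaOne.Ξ a = P.Ξ A :=
  IsDeltaOneInfo.unique a.2.choose_spec h

end CompProblem

/-! ### Approximate point spectrum -/

/-- The approximate point spectrum of a bounded operator: all `z` for which there are unit vectors
`f_n` with `‖(T - z) f_n‖ → 0`. -/
def approxPointSpectrum {E : Type*} [NormedAddCommGroup E] [NormedSpace ℂ E] (T : E →L[ℂ] E) :
    Set ℂ :=
  {z | ∃ f : ℕ → E, (∀ n, ‖f n‖ = 1) ∧ Tendsto (fun n => ‖T (f n) - z • f n‖) atTop (𝓝 0)}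

theorem mem_approxPointSpectrum_iff {E : Type*} [NormedAddCommGroup E] [NormedSpace ℂ E]
    (T : E →L[ℂ] E) (z : ℂ) :
    z ∈ approxPointSpectrum T ↔ ∀ ε : ℝ, 0 < ε → ∃ f : E, ‖f‖ = 1 ∧ ‖T f - z • f‖ < ε := by
  constructor
  · rintro ⟨f, hf, hlim⟩ ε hε
    obtain ⟨n, hn⟩ := (hlim.eventually (gt_mem_nhds hε)).exists
    exact ⟨f n, hf n, hn⟩
  · intro h
    choose f hf hlt using fun n : ℕ => h (1 / ((n : ℝ) + 1)) (by positivity)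
    exact ⟨f, hf, squeeze_zero (fun _ => norm_nonneg _) (fun n => (hlt n).le)
      tendsto_one_div_add_atTop_nhds_zero_nat⟩

theorem isClosed_approxPointSpectrum {E : Type*} [NormedAddCommGroup E] [NormedSpace ℂ E]
    (T : E →L[ℂ] E) : IsClosed (approxPointSpectrum T) := by
  refine isClosed_of_closure_subset fun z hz => ?_
  rw [mem_approxPointSpectrum_iff]
  intro ε hε
  obtain ⟨w, hw, hzw⟩ := Metric.mem_closure_iff.1 hz (ε / 2) (by positivity)
  obtain ⟨f, hf, hlt⟩ := (mem_approxPointSpectrum_iff T w).1 hw (ε / 2) (by positivity)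
  refine ⟨f, hf, ?_⟩
  have h1 : T f - z • f = (T f - w • f) - (z - w) • f := by
    rw [sub_smul]; abel
  have h2 : ‖(z - w) • f‖ = dist z w := by
    rw [norm_smul, hf, mul_one, dist_eq_norm]
  rw [h1]
  calc ‖(T f - w • f) - (z - w) • f‖ ≤ ‖T f - w • f‖ + ‖(z - w) • f‖ := norm_sub_le _ _
    _ < ε := by rw [h2]; linarith

theorem norm_le_of_mem_approxPointSpectrum {E : Type*} [NormedAddCommGroup E] [NormedSpace ℂ E]
    (T : E →L[ℂ] E) {z : ℂ} (hz : z ∈ approxPointSpectrum T) : ‖z‖ ≤ ‖T‖ := by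
  refine le_of_forall_pos_le_add fun ε hε => ?_
  obtain ⟨f, hf, hlt⟩ := (mem_approxPointSpectrum_iff T z).1 hz ε hε
  have h1 : ‖z • f‖ ≤ ‖T f‖ + ‖T f - z • f‖ := by
    have := norm_sub_le (T f) (T f - z • f)
    simpa using this
  have h2 : ‖T f‖ ≤ ‖T‖ := by simpa [hf] using T.le_opNorm f
  have h3 : ‖z • f‖ = ‖z‖ := by rw [norm_smul, hf, mul_one]
  linarith

theorem isCompact_approxPointSpectrum {E : Type*} [NormedAddCommGroup E] [NormedSpace ℂ E]
    (T : E →L[ℂ] E) : IsCompact (approxPointSpectrum T) :=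
  Metric.isCompact_of_isClosed_isBounded (isClosed_approxPointSpectrum T)
    (isBounded_iff_forall_norm_le.2 ⟨‖T‖, fun _ hz => norm_le_of_mem_approxPointSpectrum T hz⟩)

/-! ### Koopman operators of measure-preserving maps -/

section Koopman

variable {X : Type*} [MeasurableSpace X]

/-- The class of measurable measure-preserving maps `F : X → X` (functions, not classes modulo null
sets). -/
abbrev MPMap (ω : Measure X) : Type _ := {F : X → X // MeasurePreserving F ω ω}

/-- The Koopman operator `f ↦ f ∘ F` on `L^p(X, ω)`. -/
noncomputable def koopman (p : ℝ≥0∞) [Fact (1 ≤ p)] (ω : Measure X) (F : MPMap ω) :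
    Lp ℂ p ω →L[ℂ] Lp ℂ p ω :=
  (Lp.compMeasurePreservingₗᵢ ℂ F.1 F.2).toContinuousLinearMap

theorem koopman_ae_eq (p : ℝ≥0∞) [Fact (1 ≤ p)] (ω : Measure X) (F : MPMap ω) (f : Lp ℂ p ω) :
    koopman p ω F f =ᵐ[ω] fun x => f (F.1 x) :=
  Lp.coeFn_compMeasurePreserving f F.2

theorem approxPointSpectrum_koopman_nonempty (p : ℝ≥0∞) [Fact (1 ≤ p)] (ω : Measure X)
    [IsProbabilityMeasure ω] (F : MPMap ω) : (approxPointSpectrum (koopman p ω F)).Nonempty := by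
  refine ⟨1, fun _ => Lp.const p ω (1 : ℂ), fun _ => ?_, ?_⟩
  · have hp : p ≠ 0 := (zero_lt_one.trans_le (Fact.out : 1 ≤ p)).ne'
    rw [Lp.norm_const (p := p) (μ := ω) (c := (1 : ℂ)) hp]
    simp
  · have h : koopman p ω F (Lp.const p ω (1 : ℂ)) = Lp.const p ω (1 : ℂ) := by
      apply Lp.ext
      refine (koopman_ae_eq p ω F _).trans ?_
      have h1 := Lp.coeFn_const p ω (1 : ℂ)
      have h2 := F.2.quasiMeasurePreserving.ae_eq_comp h1
      filter_upwards [h1, h2] with x hx hy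
      rw [hx]
      exact hy
    simp [h]

/-- `σ_ap(K_F)` as a point of the space of non-empty compact subsets of `ℂ`, which carries the
Hausdorff metric. -/
noncomputable def koopmanApSpectrum (p : ℝ≥0∞) [Fact (1 ≤ p)] (ω : Measure X)
    [IsProbabilityMeasure ω] (F : MPMap ω) : NonemptyCompacts ℂ where
  carrier := approxPointSpectrum (koopman p ω F)
  isCompact' := isCompact_approxPointSpectrum _
  nonempty' := approxPointSpectrum_koopman_nonempty p ω F

/-- The problem of computing `σ_ap(K_F)` on `L^p(X, ω)` from point evaluations `F ↦ F x`, for all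
measurable measure-preserving `F`. -/
noncomputable def koopmanApProblem (p : ℝ≥0∞) [Fact (1 ≤ p)] (ω : Measure X)
    [IsProbabilityMeasure ω] : CompProblem (MPMap ω) (NonemptyCompacts ℂ) X where
  Ξ := koopmanApSpectrum p ω
  Λ := Set.range fun (x : X) (F : MPMap ω) => F.1 x
  consistent := by
    intro F G h
    by_contra hc
    push Not at hc
    apply h
    have hFG : F = G := Subtype.ext (funext fun x => hc _ ⟨x, rfl⟩)
    rw [hFG]

end Koopman

/-! ### Towers only see countably many evaluations -/

/-! A tower of finite height has only countably many base algorithms, and each reads finitely many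
evaluations of a given input. Passing to limits adds no information, so countably many evaluations
determine the value of the problem function at that input
(`GeneralTower.exists_countable_determining`).

At the identity map this fails. A countable set `C` of points meets the atomless part of `ω` in a
null set, so what is left of that part still contains disjoint sets `A`, `B` of equal positive
measure (`exists_halves`). A measure-preserving map exchanging them and fixing all other points
(`exists_measurePreserving_exchange`) agrees with the identity on `C`. Yet `1_A - 1_B` is an
eigenfunction of its Koopman operator for `-1`, a value absent from the spectrum of the identity.

Hence no height suffices and the index is infinite. Exact values are admissible `Δ_1`-information,
so the argument carries over to that problem. -/

namespace CompProblem

variable {Ω M V : Type*}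

/-- A general tower of any height uses, on a given input `A`, only countably many evaluations; they
determine the value of the problem function at `A`. -/
theorem GeneralTower.exists_countable_determining [MetricSpace M] {P : CompProblem Ω M V} {k : ℕ}
    (T : P.GeneralTower k) (A : Ω) :
    ∃ C : Set (Ω → V), C.Countable ∧ C ⊆ P.Λ ∧
      ∀ B : Ω, (∀ f ∈ C, f A = f B) → P.Ξ A = P.Ξ B := by
  choose Q hQ hQΓ using T.base
  refine ⟨⋃ (l : List ℕ) (h : l.length = k), (Q l h A : Set (Ω → V)),
    Set.countable_iUnion fun l => Set.countable_iUnion fun h => (Q l h A).countable_toSet,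
    Set.iUnion_subset fun l => Set.iUnion_subset fun h => (hQ l h A).2, fun B hB => ?_⟩
  -- Induction on the number `j` of missing indices: the base algorithms agree by the choice of `C`,
  -- and equal sequences have equal limits.
  have key : ∀ (j : ℕ) (l : List ℕ), l.length + j = k → T.Γ l A = T.Γ l B := by
    intro j
    induction j with
    | zero =>
      intro l hl
      exact (hQΓ l hl A B fun f hf => hB f (Set.mem_iUnion₂.2 ⟨l, hl, hf⟩)).2
    | succ j ih =>
      intro l hl
      have hA := T.lim l (by omega) A
      simp only [fun n : ℕ => ih (l ++ [n]) (by simp; omega)] at hA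
      exact tendsto_nhds_unique hA (T.lim l (by omega) B)
  simpa only [T.top] using key k [] (by simp)

/-- If every countable set of evaluations fails to determine the value of the problem function at
`A`, then there is no general tower of any height. -/
theorem isEmpty_generalTower [MetricSpace M] {P : CompProblem Ω M V} (A : Ω)
    (h : ∀ C ⊆ P.Λ, C.Countable → ∃ B, (∀ f ∈ C, f A = f B) ∧ P.Ξ A ≠ P.Ξ B) (k : ℕ) :
    IsEmpty (P.GeneralTower k) := by
  refine ⟨fun T => ?_⟩
  obtain ⟨C, hC, hCΛ, hdet⟩ := T.exists_countable_determining A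
  obtain ⟨B, hAB, hne⟩ := h C hCΛ hC
  exact hne (hdet B hAB)

theorem SCI_eq_top [MetricSpace M] {P : CompProblem Ω M V} (h : ∀ k, IsEmpty (P.GeneralTower k)) :
    P.SCI = ⊤ := by
  refine sInf_eq_top.2 ?_
  rintro _ ⟨k, -, hk⟩
  exact ((not_nonempty_iff.2 (h k)) hk).elim

/-- The exact evaluations of an input, as `Δ_1`-information. -/
def exactInfo [MetricSpace V] (P : CompProblem Ω M V) (A : Ω) : P.DeltaOneInput :=
  ⟨fun f _ => f.1 A, A, fun f n => by simp⟩

theorem deltaOne_exactInfo [MetricSpace V] (P : CompProblem Ω M V) (A : Ω) :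
    P.deltaOne.Ξ (P.exactInfo A) = P.Ξ A :=
  P.deltaOne_apply _ A fun f n => by simp [exactInfo]

/-- If countably many exact evaluations never determine the problem function at `A`, then neither
do countably many entries of `Δ_1`-information on `A`. -/
theorem deltaOne_not_determined [MetricSpace V] {P : CompProblem Ω M V} (A : Ω)
    (h : ∀ C ⊆ P.Λ, C.Countable → ∃ B, (∀ f ∈ C, f A = f B) ∧ P.Ξ A ≠ P.Ξ B) :
    ∀ C ⊆ P.deltaOne.Λ, C.Countable →
      ∃ b, (∀ f ∈ C, f (P.exactInfo A) = f b) ∧ P.deltaOne.Ξ (P.exactInfo A) ≠ P.deltaOne.Ξ b := by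
  intro C hCΛ hC
  have := hC.to_subtype
  choose j hj using fun f : C => hCΛ f.2
  obtain ⟨B, hAB, hne⟩ := h (Set.range fun f => ((j f).1 : Ω → V))
    (by rintro _ ⟨f, rfl⟩; exact (j f).1.2) (Set.countable_range _)
  -- In exact information the entry does not depend on the precision index, so agreement of the
  -- underlying evaluations is enough.
  refine ⟨P.exactInfo B, fun f hf => ?_, by simpa only [deltaOne_exactInfo] using hne⟩
  rw [show f = _ from (hj ⟨f, hf⟩).symm]
  exact hAB _ ⟨⟨f, hf⟩, rfl⟩

end CompProblem

/-! ### Transport of non-atomic measures -/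

/-- The distribution function of a non-atomic probability measure on `ℝ` is continuous. -/
theorem continuous_cdf_of_nullSingletonClass (ν : Measure ℝ) [IsProbabilityMeasure ν]
    [NullSingletonClass ν] : Continuous (ProbabilityTheory.cdf ν) := by
  refine continuous_iff_continuousAt.2 fun x => ?_
  refine (ProbabilityTheory.monotone_cdf ν).continuousAt_iff_leftLim_eq_rightLim.2 ?_
  rw [StieltjesFunction.rightLim_eq]
  have h : (ProbabilityTheory.cdf ν).measure {x} = 0 := by
    rw [ProbabilityTheory.measure_cdf]; exact measure_singleton x
  rw [StieltjesFunction.measure_singleton, ENNReal.ofReal_eq_zero] at h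
  exact le_antisymm ((ProbabilityTheory.monotone_cdf ν).leftLim_le le_rfl) (by linarith)

/-- The distribution function of a non-atomic probability measure has uniform law. -/
theorem measure_cdf_le (ν : Measure ℝ) [IsProbabilityMeasure ν] [NullSingletonClass ν] {t : ℝ}
    (h0 : 0 ≤ t) (h1 : t ≤ 1) : ν {x | ProbabilityTheory.cdf ν x ≤ t} = ENNReal.ofReal t := by
  have hmono := ProbabilityTheory.monotone_cdf ν
  have hcont := continuous_cdf_of_nullSingletonClass ν
  rcases h1.eq_or_lt with rfl | h1
  -- The value `1` need not be attained, and the sublevel set is then all of `ℝ`.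
  · simp [ProbabilityTheory.cdf_le_one]
  have hne : 0 < t → ∃ x, ProbabilityTheory.cdf ν x = t := fun h0 => by
    obtain ⟨a, ha⟩ := ((ProbabilityTheory.tendsto_cdf_atBot ν).eventually (gt_mem_nhds h0)).exists
    obtain ⟨b, hb⟩ := ((ProbabilityTheory.tendsto_cdf_atTop ν).eventually (lt_mem_nhds h1)).exists
    exact mem_range_of_exists_le_of_exists_ge hcont ⟨a, ha.le⟩ ⟨b, hb.le⟩
  rcases Set.eq_empty_or_nonempty {x | ProbabilityTheory.cdf ν x ≤ t} with hS | hS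
  · rcases h0.eq_or_lt with rfl | h0
    · simp [hS]
    · obtain ⟨x, hx⟩ := hne h0
      exact absurd hS (Set.nonempty_iff_ne_empty.1 ⟨x, hx.le⟩)
  obtain ⟨b, hb⟩ := ((ProbabilityTheory.tendsto_cdf_atTop ν).eventually (lt_mem_nhds h1)).exists
  have hbdd : BddAbove {x | ProbabilityTheory.cdf ν x ≤ t} :=
    ⟨b, fun x hx => le_of_not_gt fun hlt => (hb.trans_le (hmono hlt.le)).not_ge hx⟩
  have hmem := (isClosed_le hcont continuous_const).csSup_mem hS hbdd
  set s := sSup {x | ProbabilityTheory.cdf ν x ≤ t}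
  -- By continuity the sublevel set contains its supremum `s`, so it is a half-line of measure `cdf
  -- ν s`.
  have hIic : {x | ProbabilityTheory.cdf ν x ≤ t} = Set.Iic s :=
    Set.Subset.antisymm (fun x hx => le_csSup hbdd hx) fun x hx => (hmono hx).trans hmem
  have hs : ProbabilityTheory.cdf ν s = t := by
    refine le_antisymm hmem ?_
    rcases h0.eq_or_lt with rfl | h0
    · exact ProbabilityTheory.cdf_nonneg ν s
    · obtain ⟨x, hx⟩ := hne h0
      exact hx ▸ hmono (le_csSup hbdd hx.le)
  rw [hIic, ← ProbabilityTheory.ofReal_cdf, hs]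

/-- A non-atomic probability measure on a standard Borel space has a measurable uniformly
distributed function. -/
theorem exists_measurePreserving_unitInterval {X : Type*} [MeasurableSpace X]
    [StandardBorelSpace X] (ν : Measure X) [IsProbabilityMeasure ν] [NullSingletonClass ν] :
    ∃ φ : X → unitInterval, MeasurePreserving φ ν volume := by
  obtain ⟨e, he⟩ := exists_measurableEmbedding_real X
  have : IsProbabilityMeasure (ν.map e) := Measure.isProbabilityMeasure_map he.measurable.aemeasurable
  have : NullSingletonClass (ν.map e) := ⟨fun t => by
    rw [he.map_apply]
    exact ((Set.subsingleton_singleton).preimage he.injective).measure_zero ν⟩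
  let c : X → unitInterval := fun x => ⟨ProbabilityTheory.cdf (ν.map e) (e x),
    ProbabilityTheory.cdf_nonneg _ _, ProbabilityTheory.cdf_le_one _ _⟩
  have hc : Measurable c := Measurable.subtype_mk
    ((ProbabilityTheory.monotone_cdf (ν.map e)).measurable.comp he.measurable)
  have : IsProbabilityMeasure (ν.map c) := Measure.isProbabilityMeasure_map hc.aemeasurable
  refine ⟨c, hc, Measure.ext_of_Iic _ _ fun t => ?_⟩
  rw [Measure.map_apply hc measurableSet_Iic, unitInterval.volume_Iic,
    ← measure_cdf_le (ν.map e) t.2.1 t.2.2, he.map_apply]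
  rfl

/-- A non-atomic finite measure on a standard Borel space can be transported to any measure of the
same total mass. -/
theorem exists_measurePreserving_of_measure_univ_eq {X Y : Type*} [MeasurableSpace X]
    [StandardBorelSpace X] [MeasurableSpace Y] [StandardBorelSpace Y] (μ : Measure X)
    (ν : Measure Y) [IsFiniteMeasure μ] [NeZero μ] [NullSingletonClass μ]
    (h : μ Set.univ = ν Set.univ) : ∃ g : X → Y, MeasurePreserving g μ ν := by
  have hμ0 : μ Set.univ ≠ 0 := NeZero.ne _
  have hμt : μ Set.univ ≠ ∞ := measure_ne_top _ _
  have : IsProbabilityMeasure ((μ Set.univ)⁻¹ • μ) :=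
    ⟨by simp⟩
  have : IsProbabilityMeasure ((μ Set.univ)⁻¹ • ν) :=
    ⟨by simp [← h, ENNReal.inv_mul_cancel hμ0 hμt]⟩
  have : NullSingletonClass ((μ Set.univ)⁻¹ • μ) := ⟨fun x => by simp⟩
  obtain ⟨φ, hφ⟩ := exists_measurePreserving_unitInterval ((μ Set.univ)⁻¹ • μ)
  have : Nonempty Y := Measure.nonempty_of_neZero ((μ Set.univ)⁻¹ • ν)
  -- Every probability law on `Y` is an image of the uniform law, so the transport factors through
  -- the unit interval.
  obtain ⟨q, hq, hqν⟩ := Measure.exists_measurable_map_eq ((μ Set.univ)⁻¹ • ν)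
  have hg := (MeasurePreserving.mk hq hqν).comp hφ
  have h1 := hg.smul_measure (μ Set.univ)
  simp only [smul_smul, ENNReal.mul_inv_cancel hμ0 hμt, one_smul] at h1
  exact ⟨_, h1⟩

/-- A measurable set of positive finite measure without atoms splits into two halves. -/
theorem exists_halves {X : Type*} [MeasurableSpace X] [StandardBorelSpace X] (μ : Measure X)
    [IsFiniteMeasure μ] {N : Set X} (hN : MeasurableSet N) (hN0 : μ N ≠ 0)
    (hnull : ∀ x ∈ N, μ {x} = 0) :
    ∃ A B : Set X, MeasurableSet A ∧ MeasurableSet B ∧ A ⊆ N ∧ B ⊆ N ∧ Disjoint A B ∧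
      μ A = μ B ∧ μ A ≠ 0 := by
  have : NeZero (μ.restrict N) := ⟨by simpa using hN0⟩
  have : NullSingletonClass (μ.restrict N) := ⟨fun x => by
    rw [Measure.restrict_apply' hN]
    by_cases hx : x ∈ N
    · exact measure_mono_null Set.inter_subset_left (hnull x hx)
    · simp [Set.singleton_inter_eq_empty.2 hx]⟩
  obtain ⟨φ, hφ⟩ := exists_measurePreserving_of_measure_univ_eq (μ.restrict N)
    (μ N • (volume : Measure unitInterval)) (by simp)
  let t : unitInterval := ⟨1 / 2, by norm_num, by norm_num⟩
  have hA : μ (φ ⁻¹' Set.Iic t ∩ N) = μ N * ENNReal.ofReal (1 / 2) := by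
    rw [← Measure.restrict_apply (hφ.measurable measurableSet_Iic),
      hφ.measure_preimage measurableSet_Iic.nullMeasurableSet]
    simp [unitInterval.volume_Iic, t]
  have hB : μ (φ ⁻¹' Set.Ioi t ∩ N) = μ N * ENNReal.ofReal (1 / 2) := by
    rw [← Measure.restrict_apply (hφ.measurable measurableSet_Ioi),
      hφ.measure_preimage measurableSet_Ioi.nullMeasurableSet]
    simp only [Measure.smul_apply, unitInterval.volume_Ioi, t, smul_eq_mul]
    norm_num
  refine ⟨φ ⁻¹' Set.Iic t ∩ N, φ ⁻¹' Set.Ioi t ∩ N, (hφ.measurable measurableSet_Iic).inter hN,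
    (hφ.measurable measurableSet_Ioi).inter hN, Set.inter_subset_right, Set.inter_subset_right,
    ?_, hA.trans hB.symm, ?_⟩
  · refine Set.disjoint_left.2 fun x hx hy => ?_
    exact not_lt.2 (show φ x ≤ t from hx.1) (show t < φ x from hy.1)
  · rw [hA]
    exact mul_ne_zero hN0 (by simp)

/-- Two disjoint sets of equal positive measure without atoms can be exchanged by a
measure-preserving map that is the identity elsewhere. -/
theorem exists_measurePreserving_exchange {X : Type*} [MeasurableSpace X] [StandardBorelSpace X]
    (μ : Measure X) [IsFiniteMeasure μ] {A B : Set X} (hA : MeasurableSet A)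
    (hB : MeasurableSet B) (hAB : Disjoint A B) (heq : μ A = μ B) (hA0 : μ A ≠ 0)
    (hnull : ∀ x ∈ A ∪ B, μ {x} = 0) :
    ∃ F : X → X, MeasurePreserving F μ μ ∧ (∀ x, x ∉ A ∪ B → F x = x) ∧
      (∀ᵐ x ∂μ, x ∈ A → F x ∈ B) ∧ ∀ᵐ x ∂μ, x ∈ B → F x ∈ A := by
  classical
  have key : ∀ S T : Set X, MeasurableSet S → (∀ x ∈ S, μ {x} = 0) → μ S ≠ 0 → μ S = μ T →
      ∃ g : X → X, MeasurePreserving g (μ.restrict S) (μ.restrict T) := by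
    intro S T hS hSn hS0 hST
    have : NeZero (μ.restrict S) := ⟨by simpa using hS0⟩
    have : NullSingletonClass (μ.restrict S) := ⟨fun x => by
      rw [Measure.restrict_apply' hS]
      by_cases hx : x ∈ S
      · exact measure_mono_null Set.inter_subset_left (hSn x hx)
      · simp [Set.singleton_inter_eq_empty.2 hx]⟩
    exact exists_measurePreserving_of_measure_univ_eq _ _ (by simpa using hST)
  -- The maps `g` and `k` need not be inverse to each other: only the image measures matter.
  obtain ⟨g, hg⟩ := key A B hA (fun x hx => hnull x (.inl hx)) hA0 heq
  obtain ⟨k, hk⟩ := key B A hB (fun x hx => hnull x (.inr hx)) (heq ▸ hA0) heq.symm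
  have hFm : Measurable (A.piecewise g (B.piecewise k id)) :=
    hg.measurable.piecewise hA (hk.measurable.piecewise hB measurable_id)
  have hFA : ∀ x ∈ A, A.piecewise g (B.piecewise k id) x = g x := fun x hx => by simp [hx]
  have hFB : ∀ x ∈ B, A.piecewise g (B.piecewise k id) x = k x := fun x hx => by
    simp [hx, Set.disjoint_right.1 hAB hx]
  have hFC : ∀ x, x ∉ A ∪ B → A.piecewise g (B.piecewise k id) x = x := fun x hx => by
    rw [Set.mem_union, not_or] at hx
    simp [hx]
  generalize A.piecewise g (B.piecewise k id) = F at hFm hFA hFB hFC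
  have hsum : μ = μ.restrict A + μ.restrict B + μ.restrict (A ∪ B)ᶜ := by
    rw [← Measure.restrict_union hAB hB, Measure.restrict_add_restrict_compl (hA.union hB)]
  have hmapA : (μ.restrict A).map F = μ.restrict B := by
    rw [← hg.map_eq]
    exact Measure.map_congr ((ae_restrict_mem hA).mono hFA)
  have hmapB : (μ.restrict B).map F = μ.restrict A := by
    rw [← hk.map_eq]
    exact Measure.map_congr ((ae_restrict_mem hB).mono hFB)
  have hmapC : (μ.restrict (A ∪ B)ᶜ).map F = μ.restrict (A ∪ B)ᶜ := by
    have h : F =ᵐ[μ.restrict (A ∪ B)ᶜ] id := (ae_restrict_mem (hA.union hB).compl).mono hFC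
    rw [Measure.map_congr h, Measure.map_id]
  refine ⟨F, ⟨hFm, ?_⟩, hFC, ?_, ?_⟩
  · conv_lhs => rw [hsum]
    rw [Measure.map_add _ _ hFm, Measure.map_add _ _ hFm, hmapA, hmapB, hmapC,
      add_comm (μ.restrict B), ← hsum]
  -- The transport controls only the image measure, so points of `A` land in `B` up to a null set.
  · rw [← ae_restrict_iff' hA]
    exact ae_of_ae_map hFm.aemeasurable (hmapA ▸ ae_restrict_mem hB)
  · rw [← ae_restrict_iff' hB]
    exact ae_of_ae_map hFm.aemeasurable (hmapB ▸ ae_restrict_mem hA)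

/-! ### Spectral values of Koopman operators -/

section Koopman

variable {X : Type*} [MeasurableSpace X]

/-- A measure-preserving map that exchanges two disjoint sets of positive measure up to null sets
has `-1` in the approximate point spectrum of its Koopman operator. -/
theorem neg_one_mem_approxPointSpectrum_koopman (p : ℝ≥0∞) [Fact (1 ≤ p)] (ω : Measure X)
    [IsFiniteMeasure ω] (F : MPMap ω) {A B : Set X} (hA : MeasurableSet A) (hB : MeasurableSet B)
    (hAB : Disjoint A B) (hA0 : ω A ≠ 0) (hFA : ∀ᵐ x ∂ω, x ∈ A → F.1 x ∈ B)
    (hFB : ∀ᵐ x ∂ω, x ∈ B → F.1 x ∈ A) (hFC : ∀ x, x ∉ A ∪ B → F.1 x = x) :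
    (-1 : ℂ) ∈ approxPointSpectrum (koopman p ω F) := by
  let h : X → ℂ := A.indicator 1 - B.indicator 1
  have hh : MemLp h p ω := ((memLp_const (1 : ℂ)).indicator hA).sub
    ((memLp_const (1 : ℂ)).indicator hB)
  have hA1 : ∀ x ∈ A, h x = 1 := fun x hx => by
    simp [h, hx, Set.disjoint_left.1 hAB hx]
  have hB1 : ∀ x ∈ B, h x = -1 := fun x hx => by
    simp [h, hx, Set.disjoint_right.1 hAB hx]
  have hC1 : ∀ x, x ∉ A ∪ B → h x = 0 := fun x hx => by
    rw [Set.mem_union, not_or] at hx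
    simp [h, hx]
  have hne : hh.toLp h ≠ 0 := fun h0 => by
    have h1 : h =ᵐ[ω] 0 := (hh.coeFn_toLp.symm.trans (h0 ▸ Lp.coeFn_zero ℂ p ω))
    refine hA0 (measure_mono_null (fun x hx => ?_) (ae_iff.1 h1))
    simp [hA1 x hx]
  have heig : koopman p ω F (hh.toLp h) = -hh.toLp h := by
    apply Lp.ext
    have h2 := F.2.quasiMeasurePreserving.ae_eq_comp hh.coeFn_toLp
    filter_upwards [koopman_ae_eq p ω F (hh.toLp h), Lp.coeFn_neg (hh.toLp h), hh.coeFn_toLp, h2,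
      hFA, hFB] with x h1 h2 h3 h4 h5 h6
    simp only [Function.comp_apply] at h4
    rw [h1, h2, Pi.neg_apply, h3, h4]
    by_cases hxA : x ∈ A
    · rw [hA1 x hxA, hB1 _ (h5 hxA)]
    by_cases hxB : x ∈ B
    · rw [hB1 x hxB, hA1 _ (h6 hxB), neg_neg]
    have hx : x ∉ A ∪ B := by simp [hxA, hxB]
    rw [hFC x hx, hC1 x hx, neg_zero]
  rw [mem_approxPointSpectrum_iff]
  intro ε hε
  -- The normalised eigenvector has defect zero and serves every `ε`.
  refine ⟨((‖hh.toLp h‖⁻¹ : ℝ) : ℂ) • hh.toLp h, ?_, ?_⟩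
  · rw [norm_smul, Complex.norm_real, norm_inv, norm_norm,
      inv_mul_cancel₀ (norm_ne_zero_iff.2 hne)]
  · rw [map_smul, heig]
    simpa using hε

theorem neg_one_notMem_approxPointSpectrum_koopman_id (p : ℝ≥0∞) [Fact (1 ≤ p)] (ω : Measure X) :
    (-1 : ℂ) ∉ approxPointSpectrum (koopman p ω ⟨id, MeasurePreserving.id ω⟩) := by
  intro hmem
  obtain ⟨f, hf, hlt⟩ := (mem_approxPointSpectrum_iff _ _).1 hmem 1 one_pos
  have hid : koopman p ω ⟨id, MeasurePreserving.id ω⟩ f = f := Lp.ext (koopman_ae_eq p ω _ f)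
  -- The defect of any unit vector at `-1` is `‖f + f‖ = 2`.
  rw [hid, neg_one_smul, sub_neg_eq_add, ← two_smul ℝ f, norm_smul, hf] at hlt
  norm_num at hlt

/-- The points that a finite measure charges form a countable set. -/
theorem countable_setOf_measure_singleton_ne_zero [MeasurableSingletonClass X] (μ : Measure X)
    [IsFiniteMeasure μ] : {x | μ {x} ≠ 0}.Countable := by
  simpa [pos_iff_ne_zero] using
    Measure.countable_meas_level_set_pos (μ := μ) (g := (id : X → X)) measurable_id

/-- Countably many values of the identity do not determine the spectrum of its Koopman operator. -/
theorem exists_koopmanApSpectrum_ne [StandardBorelSpace X] (p : ℝ≥0∞) [Fact (1 ≤ p)]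
    (ω : Measure X) [IsProbabilityMeasure ω] (hω : ω {x | ω {x} = 0} ≠ 0) {C : Set X}
    (hC : C.Countable) :
    ∃ F : MPMap ω, (∀ x ∈ C, F.1 x = x) ∧
      koopmanApSpectrum p ω ⟨id, MeasurePreserving.id ω⟩ ≠ koopmanApSpectrum p ω F := by
  -- The complement is the countable set of atoms.
  have hN : MeasurableSet {x | ω {x} = 0} := by
    have h := (countable_setOf_measure_singleton_ne_zero ω).measurableSet.compl
    simpa [Set.compl_ofPred] using h
  have hNC : ω ({x | ω {x} = 0} \ C) ≠ 0 := by
    have h0 : ω ({x | ω {x} = 0} ∩ C) = 0 := by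
      rw [← Set.biUnion_of_singleton ({x | ω {x} = 0} ∩ C)]
      exact (measure_biUnion_null_iff (hC.mono Set.inter_subset_right)).2 fun x hx => hx.1
    rwa [← measure_inter_add_sdiff _ hC.measurableSet, h0, zero_add] at hω
  obtain ⟨A, B, hA, hB, hAN, hBN, hAB, heq, hA0⟩ :=
    exists_halves ω (hN.diff hC.measurableSet) hNC fun x hx => hx.1
  have hsub := Set.union_subset hAN hBN
  obtain ⟨F, hF, hFC, hFA, hFB⟩ :=
    exists_measurePreserving_exchange ω hA hB hAB heq hA0 fun x hx => (hsub hx).1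
  refine ⟨⟨F, hF⟩, fun x hx => hFC x fun h => (hsub h).2 hx, fun h => ?_⟩
  have hmem := neg_one_mem_approxPointSpectrum_koopman p ω ⟨F, hF⟩ hA hB hAB hA0 hFA hFB hFC
  apply neg_one_notMem_approxPointSpectrum_koopman_id p ω
  exact (SetLike.ext_iff.1 h (-1)).2 hmem

theorem koopmanApProblem_not_determined [StandardBorelSpace X] (p : ℝ≥0∞) [Fact (1 ≤ p)]
    (ω : Measure X) [IsProbabilityMeasure ω] (hω : ω {x | ω {x} = 0} ≠ 0) :
    ∀ C ⊆ (koopmanApProblem p ω).Λ, C.Countable →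
      ∃ F, (∀ f ∈ C, f ⟨id, MeasurePreserving.id ω⟩ = f F) ∧
        (koopmanApProblem p ω).Ξ ⟨id, MeasurePreserving.id ω⟩ ≠ (koopmanApProblem p ω).Ξ F := by
  intro C hCΛ hC
  have := hC.to_subtype
  choose x hx using fun f : C => hCΛ f.2
  obtain ⟨F, hF, hne⟩ := exists_koopmanApSpectrum_ne p ω hω (Set.countable_range x)
  refine ⟨F, fun f hf => ?_, hne⟩
  rw [show f = _ from (hx ⟨f, hf⟩).symm]
  exact (hF _ ⟨⟨f, hf⟩, rfl⟩).symm

end Koopman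

theorem theorem5p6 {X : Type*} [MetricSpace X] [CompactSpace X] [MeasurableSpace X] [BorelSpace X]
    (ω : Measure X) [IsProbabilityMeasure ω]
    (hω : ω {x | ω {x} = 0} ≠ 0)
    (p : ℝ≥0∞) [Fact (1 ≤ p)] (hp1 : 1 < p) (hp2 : p ≠ 2) (hp_top : p < ∞) :
    ¬ (koopmanApProblem p ω).deltaOne.MemDeltaG 3 ∧
      3 ≤ (koopmanApProblem p ω).SCI ∧
      IsEmpty ((koopmanApProblem p ω).GeneralTower 2) := by
  -- A compact metric space is Polish, which supplies the standard Borel structure.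
  have h := koopmanApProblem_not_determined p ω hω
  have hempty := CompProblem.isEmpty_generalTower _ h
  have hempty' := CompProblem.isEmpty_generalTower _ (CompProblem.deltaOne_not_determined _ h)
  refine ⟨fun hmem => ?_, by simp [CompProblem.SCI_eq_top hempty], hempty 2⟩
  rw [CompProblem.MemDeltaG, CompProblem.SCI_eq_top hempty', top_le_iff] at hmem
  exact ENat.natCast_ne_top _ hmem
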